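/- Let $G$ be a finite group and $\mathbb{F}$ a field whose characteristic does not divide $|G|$. For a finite dimensional representation $V$ of $G$ over $\mathbb{F}$, let $\mathbb{F}[V]$ be the coordinate ring of $V$ (the polynomial ring over $\mathbb{F}$ in the coordinate functions with respect to a basis of $V$), on which $G$ acts by $(g\cdot f)(v)=f(g^{-1}v)$, and let $\mathbb{F}[V]^G$ be the algebra of $G$-invariant polynomials. Let $\beta_{\mathrm{sep}}(G,V)$ be the minimal positive integer $d$ such that for all $v,w\in V$ with $G\cdot v\neq G\cdot w$ there is an $f\in\mathbb{F}[V]^G$ of degree at most $d$ with $f(v)\neq f(w)$. The separating Noether number $\beta_{\mathrm{sep}}^{\mathbb{F}}(G)$ of $G$ over $\mathbb{F}$ is the maximum of $\beta_{\mathrm{sep}}(G,V)$ as $V$ ranges over the finite dimensional representations of $G$ over $\mathbb{F}$. Proposition. Let $\mathrm{C}_3$ be the cyclic group of order $3$. Then $$\beta_{\mathrm{sep}}^{\mathbb{R}}(\mathrm{C}_3\times\mathrm{C}_3)=3 .$$ -/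

import Mathlib

namespace SepInv

universe u

section Coordinates

variable {F G V ι : Type*} [Field F] [Group G] [AddCommGroup V] [Module F V] [Fintype ι]

/-- A linear form `φ` on `V`, as a homogeneous linear polynomial in the coordinate functions
`X i` belonging to the basis `b` of `V`. -/
noncomputable def linearForm (b : Module.Basis ι F V) (φ : Module.Dual F V) : MvPolynomial ι F :=
  ∑ i, MvPolynomial.C (φ (b i)) * MvPolynomial.X i

/-- The value `f(v)` of an element `f` of the coordinate ring at a vector `v` of `V`. -/
noncomputable def evalAt (b : Module.Basis ι F V) (f : MvPolynomial ι F) (v : V) : F :=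
  MvPolynomial.eval (fun i => b.repr v i) f

/-- The algebra endomorphism `f ↦ g • f` of the coordinate ring `F[V]`, induced by
the representation `ρ`. It is the substitution of the linear form `v ↦ (i-th coordinate of g⁻¹ v)`
for the variable `X i`, so that `(g • f)(v) = f(g⁻¹ v)`. -/
noncomputable def polyAction (b : Module.Basis ι F V) (ρ : Representation F G V) (g : G) :
    MvPolynomial ι F →ₐ[F] MvPolynomial ι F :=
  MvPolynomial.aeval (fun i => linearForm b (b.coord i ∘ₗ ρ g⁻¹))

/-- The algebra `F[V]^G` of polynomial invariants. -/
noncomputable def invariants (b : Module.Basis ι F V) (ρ : Representation F G V) :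
    Subalgebra F (MvPolynomial ι F) :=
  ⨅ g : G, AlgHom.equalizer (polyAction b ρ g) (AlgHom.id F (MvPolynomial ι F))

/-- The `G`-orbit of `v`. -/
def orbit (ρ : Representation F G V) (v : V) : Set V :=
  Set.range (fun g : G => ρ g v)

/-- Any two different `G`-orbits in `V` are separated by a polynomial invariant of degree
at most `d`. -/
def SeparatedInDegree (b : Module.Basis ι F V) (ρ : Representation F G V) (d : ℕ) : Prop :=
  ∀ v w : V, orbit ρ v ≠ orbit ρ w →
    ∃ f ∈ invariants b ρ, f.totalDegree ≤ d ∧ evalAt b f v ≠ evalAt b f w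

end Coordinates

/-- `β_sep(G, V)`: the minimal positive integer `d` such that the different `G`-orbits in `V` are
separated by invariants of degree at most `d` (it would be `⊤` if there were no such `d`). The
coordinates are taken with respect to a chosen basis of `V`. -/
noncomputable def betaSep {F G V : Type*} [Field F] [Group G] [AddCommGroup V] [Module F V]
    [FiniteDimensional F V] (ρ : Representation F G V) : ℕ∞ :=
  sInf {e : ℕ∞ | ∃ d : ℕ, 0 < d ∧ SeparatedInDegree (Module.finBasis F V) ρ d ∧ e = (d : ℕ∞)}

/-- The set of all values `β_sep(G, V)`, where `V` ranges over the finite dimensional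
representations of `G` over `F`. -/
def betaSepValues (F : Type u) (G : Type*) [Field F] [Group G] : Set ℕ∞ :=
  {e : ℕ∞ | ∃ (V : Type u) (_ : AddCommGroup V) (_ : Module F V) (_ : FiniteDimensional F V)
    (ρ : Representation F G V), e = betaSep ρ}

/-- The separating Noether number `β_sep^F(G)`: the maximum of `β_sep(G, V)` over all finite
dimensional representations `V` of `G` over `F`, as a supremum in `ℕ∞` (a finite supremum of a
nonempty subset of `ℕ∞` is attained, hence a maximum). -/
noncomputable def separatingNoetherNumber (F : Type u) (G : Type*) [Field F] [Group G] : ℕ∞ :=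
  sSup (betaSepValues F G)

end SepInv

/-!
The group `C₃ × C₃` acts on a real representation `V` through characters after complexification.
Instead of decomposing `V`, the proof uses the weight functionals: real-linear maps `l : V → ℂ`
with `l (g v) = χ_a(g) l v` for a character `χ_a`, `a ∈ (ℤ/3)²`. By Fourier inversion they separate
the points of `V` (`eq_of_forall_isWeight`). The real and imaginary parts of a product of weight
functionals whose weights sum to zero are invariants, and complex conjugation negates weights.

Suppose `v` and `w` agree on all invariants of degree at most three. The products `l * conj m`, with
`l`, `m` of the same weight `a`, show that the values at `w` of all functionals of weight `a` arise
from those at `v` by one common phase, and `l ^ 3` shows that this phase is a cube root of unity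
`exp (2πi k(a) / 3)` (`exists_phase`). The products of three functionals show that `k` respects the
relations `a + a' + a'' = 0` among the weights not vanishing at `v`. Since in the plane over
`𝔽₃` every vector is a combination of two given independent ones with coefficients `0`, `±1`,
these relations force `k` to be linear (`exists_pairing_eq`), that is, `k` is given by an element
`g` of the group, and `w = g v`.

Degree two does not suffice for the rotation action of the first factor on `ℂ = ℝ²`: the odd part of
an invariant of degree at most two is an invariant linear form, hence zero, so `1` and `-1` are not
separated, although they lie in different orbits.
-/

namespace SepInv

/-! ### Invariants as invariant polynomial functions -/

section Coordinates

variable {F G V ι : Type*} [Field F] [Group G] [AddCommGroup V] [Module F V] [Fintype ι]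

lemma evalAt_linearForm (b : Module.Basis ι F V) (φ : Module.Dual F V) (v : V) :
    evalAt b (linearForm b φ) v = φ v := by
  conv_rhs => rw [← b.sum_repr v, map_sum]
  simp only [evalAt, linearForm, map_sum, map_mul, MvPolynomial.eval_C, MvPolynomial.eval_X,
    map_smul, smul_eq_mul, mul_comm]

lemma totalDegree_linearForm_le (b : Module.Basis ι F V) (φ : Module.Dual F V) :
    (linearForm b φ).totalDegree ≤ 1 := by
  refine MvPolynomial.totalDegree_finsetSum_le fun i _ => ?_
  refine (MvPolynomial.totalDegree_mul _ _).trans ?_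
  simp

lemma evalAt_polyAction (b : Module.Basis ι F V) (ρ : Representation F G V) (g : G)
    (f : MvPolynomial ι F) (v : V) :
    evalAt b (polyAction b ρ g f) v = evalAt b f (ρ g⁻¹ v) := by
  have h : ∀ i, MvPolynomial.eval (fun i => b.repr v i)
      (linearForm b (b.coord i ∘ₗ ρ g⁻¹)) = b.repr (ρ g⁻¹ v) i := fun i =>
    evalAt_linearForm b (b.coord i ∘ₗ ρ g⁻¹) v
  induction f using MvPolynomial.induction_on with
  | C a => simp [evalAt, polyAction]
  | add p q hp hq => simp only [evalAt, map_add] at *; rw [hp, hq]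
  | mul_X p i hp =>
    simp only [evalAt, map_mul] at *
    rw [hp, polyAction, MvPolynomial.aeval_X, h, MvPolynomial.eval_X]

/-- Over an infinite field, a polynomial is invariant as soon as the function it defines is. -/
lemma mem_invariants_iff [Infinite F] (b : Module.Basis ι F V) (ρ : Representation F G V)
    (f : MvPolynomial ι F) :
    f ∈ invariants b ρ ↔ ∀ g v, evalAt b f (ρ g v) = evalAt b f v := by
  simp only [invariants, Algebra.mem_iInf, AlgHom.mem_equalizer, AlgHom.id_apply]
  constructor
  · intro h g v
    have := evalAt_polyAction b ρ g⁻¹ f v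
    rwa [h, inv_inv, eq_comm] at this
  · intro h g
    refine MvPolynomial.funext fun x => ?_
    have := evalAt_polyAction b ρ g f (b.equivFun.symm x)
    have hx : (fun i => b.repr (b.equivFun.symm x) i) = x := b.equivFun.apply_symm_apply x
    rwa [h, evalAt, evalAt, hx] at this

end Coordinates

/-! ### Complex-valued polynomial functions -/

section ComplexValued

variable {G V ι : Type*} [Group G] [AddCommGroup V] [Module ℝ V]

/-- `P : V → ℂ` is polynomial of degree at most `d` on the real vector space `V`: its real and
imaginary parts are values of real polynomials of total degree at most `d`. -/
def IsComplexPoly (b : Module.Basis ι ℝ V) (d : ℕ) (P : V → ℂ) : Prop :=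
  (∃ f : MvPolynomial ι ℝ, f.totalDegree ≤ d ∧ ∀ v, evalAt b f v = (P v).re) ∧
    ∃ f : MvPolynomial ι ℝ, f.totalDegree ≤ d ∧ ∀ v, evalAt b f v = (P v).im

lemma IsComplexPoly.of_linearMap [Fintype ι] (b : Module.Basis ι ℝ V) (l : V →ₗ[ℝ] ℂ) :
    IsComplexPoly b 1 l :=
  ⟨⟨linearForm b (Complex.reLm ∘ₗ l), totalDegree_linearForm_le _ _,
      fun v => evalAt_linearForm _ _ v⟩,
    ⟨linearForm b (Complex.imLm ∘ₗ l), totalDegree_linearForm_le _ _,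
      fun v => evalAt_linearForm _ _ v⟩⟩

lemma IsComplexPoly.mul {b : Module.Basis ι ℝ V} {d e : ℕ} {P Q : V → ℂ}
    (hP : IsComplexPoly b d P) (hQ : IsComplexPoly b e Q) :
    IsComplexPoly b (d + e) fun v => P v * Q v := by
  obtain ⟨⟨p, hp, hp'⟩, q, hq, hq'⟩ := hP
  obtain ⟨⟨r, hr, hr'⟩, s, hs, hs'⟩ := hQ
  have key : ∀ x y : MvPolynomial ι ℝ, x.totalDegree ≤ d → y.totalDegree ≤ e →
      (x * y).totalDegree ≤ d + e := fun x y hx hy =>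
    (MvPolynomial.totalDegree_mul x y).trans (add_le_add hx hy)
  refine ⟨⟨p * r - q * s, ?_, fun v => ?_⟩, ⟨p * s + q * r, ?_, fun v => ?_⟩⟩
  · exact (MvPolynomial.totalDegree_sub _ _).trans (max_le (key _ _ hp hr) (key _ _ hq hs))
  · rw [Complex.mul_re, ← hp', ← hq', ← hr', ← hs']
    simp [evalAt]
  · exact (MvPolynomial.totalDegree_add _ _).trans (max_le (key _ _ hp hs) (key _ _ hq hr))
  · rw [Complex.mul_im, ← hp', ← hq', ← hr', ← hs']
    simp [evalAt]

/-- Vectors not separated by real invariants of degree at most `d` are not separated by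
complex-valued ones either. -/
lemma IsComplexPoly.eq_of_invariant [Fintype ι] {b : Module.Basis ι ℝ V} {ρ : Representation ℝ G V}
    {d e : ℕ} {P : V → ℂ} (hP : IsComplexPoly b e P) (hed : e ≤ d)
    (hinv : ∀ g v, P (ρ g v) = P v) {v w : V}
    (hvw : ∀ f ∈ invariants b ρ, f.totalDegree ≤ d → evalAt b f v = evalAt b f w) :
    P v = P w := by
  obtain ⟨⟨p, hp, hp'⟩, q, hq, hq'⟩ := hP
  apply Complex.ext
  · rw [← hp', ← hp']
    exact hvw p ((mem_invariants_iff b ρ p).2 fun g v => by rw [hp', hp', hinv]) (hp.trans hed)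
  · rw [← hq', ← hq']
    exact hvw q ((mem_invariants_iff b ρ q).2 fun g v => by rw [hq', hq', hinv]) (hq.trans hed)

end ComplexValued

/-! ### Characters of `C₃ × C₃` -/

/-- The pairing of a weight `a ∈ (ℤ/3)²` with an element `g` of `C₃ × C₃`, so that
`g ↦ ZMod.stdAddChar (pairing a g)` is the character of weight `a`. -/
def pairing (a : ZMod 3 × ZMod 3) (g : Multiplicative (ZMod 3) × Multiplicative (ZMod 3)) :
    ZMod 3 :=
  a.1 * g.1.toAdd + a.2 * g.2.toAdd

lemma pairing_add (a a' : ZMod 3 × ZMod 3)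
    (g : Multiplicative (ZMod 3) × Multiplicative (ZMod 3)) :
    pairing (a + a') g = pairing a g + pairing a' g := by
  simp only [pairing, Prod.fst_add, Prod.snd_add]; ring

lemma pairing_neg (a : ZMod 3 × ZMod 3)
    (g : Multiplicative (ZMod 3) × Multiplicative (ZMod 3)) :
    pairing (-a) g = -pairing a g := by
  simp only [pairing, Prod.fst_neg, Prod.snd_neg]; ring

@[simp] lemma pairing_zero (g : Multiplicative (ZMod 3) × Multiplicative (ZMod 3)) :
    pairing 0 g = 0 := by
  simp [pairing]

lemma pairing_mul (a : ZMod 3 × ZMod 3)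
    (g h : Multiplicative (ZMod 3) × Multiplicative (ZMod 3)) :
    pairing a (g * h) = pairing a g + pairing a h := by
  simp only [pairing, Prod.fst_mul, Prod.snd_mul, toAdd_mul]; ring

/-- A `ℤ/3`-valued function on a symmetric set `S` of weights which is odd and respects the
three-term linear relations inside `S` is evaluation at a group element. Every point of the plane
over `𝔽₃` is `0`, `±a`, `±b` or `±a ± b` for two independent `a`, `b`, so no longer relations
are needed. -/
lemma exists_pairing_eq (S : Set (ZMod 3 × ZMod 3)) (k : ZMod 3 × ZMod 3 → ZMod 3)
    (hneg : ∀ a ∈ S, -a ∈ S) (hkneg : ∀ a ∈ S, k (-a) = -k a)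
    (hk : ∀ a ∈ S, ∀ b ∈ S, ∀ c ∈ S, a + b + c = 0 → k a + k b + k c = 0) :
    ∃ g, ∀ a ∈ S, pairing a g = k a := by
  have hk0 : 0 ∈ S → k 0 = 0 := fun h0 => by
    have h := hkneg 0 h0
    rw [neg_zero] at h
    have : ∀ x : ZMod 3, x = -x → x = 0 := by decide
    exact this _ h
  have hsq : ∀ d : ZMod 3, d ≠ 0 → d * d = 1 := by decide
  by_cases h : ∃ a ∈ S, ∃ b ∈ S, a.1 * b.2 - a.2 * b.1 ≠ 0
  · obtain ⟨a, ha, b, hb, hd⟩ := h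
    -- Cramer's rule; the determinant is its own inverse.
    obtain ⟨g, hga, hgb⟩ : ∃ g, pairing a g = k a ∧ pairing b g = k b := by
      have h1 := hsq _ hd
      refine ⟨(.ofAdd ((a.1 * b.2 - a.2 * b.1) * (k a * b.2 - k b * a.2)),
        .ofAdd ((a.1 * b.2 - a.2 * b.1) * (a.1 * k b - b.1 * k a))), ?_, ?_⟩
      · simp only [pairing, toAdd_ofAdd]
        linear_combination k a * h1
      · simp only [pairing, toAdd_ofAdd]
        linear_combination k b * h1
    have hspan : ∀ a b : ZMod 3 × ZMod 3, a.1 * b.2 - a.2 * b.1 ≠ 0 → ∀ c : ZMod 3 × ZMod 3,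
        (c = 0 ∨ c = a ∨ c = -a ∨ c = b ∨ c = -b) ∨
          (a + b + c = 0 ∨ a + -b + c = 0 ∨ -a + b + c = 0 ∨ -a + -b + c = 0) := by
      set_option synthInstance.maxHeartbeats 200000 in decide
    refine ⟨g, fun c hc => ?_⟩
    have htri : ∀ x ∈ S, ∀ y ∈ S, pairing x g = k x → pairing y g = k y → x + y + c = 0 →
        pairing c g = k c := fun x hx y hy hgx hgy hxy => by
      have h1 := hk x hx y hy c hc hxy
      have h2 : pairing (x + y + c) g = 0 := by rw [hxy, pairing_zero]
      rw [pairing_add, pairing_add, hgx, hgy, ← h1] at h2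
      exact add_left_cancel h2
    have hga' : pairing (-a) g = k (-a) := by rw [pairing_neg, hga, hkneg a ha]
    have hgb' : pairing (-b) g = k (-b) := by rw [pairing_neg, hgb, hkneg b hb]
    rcases hspan a b hd c with (rfl | rfl | rfl | rfl | rfl) | (h | h | h | h)
    · rw [pairing_zero, hk0 hc]
    · exact hga
    · exact hga'
    · exact hgb
    · exact hgb'
    · exact htri _ ha _ hb hga hgb h
    · exact htri _ ha _ (hneg b hb) hga hgb' h
    · exact htri _ (hneg a ha) _ hb hga' hgb h
    · exact htri _ (hneg a ha) _ (hneg b hb) hga' hgb' h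
  · push Not at h
    by_cases h0 : ∃ a ∈ S, a ≠ 0
    · obtain ⟨a, ha, ha0⟩ := h0
      obtain ⟨g, hga⟩ : ∃ g, pairing a g = k a := by
        -- The form `x² + y²` is anisotropic over `𝔽₃`.
        have hn : ∀ a : ZMod 3 × ZMod 3, a ≠ 0 → a.1 * a.1 + a.2 * a.2 ≠ 0 := by decide
        have h1 := hsq _ (hn a ha0)
        refine ⟨(.ofAdd ((a.1 * a.1 + a.2 * a.2) * k a * a.1),
          .ofAdd ((a.1 * a.1 + a.2 * a.2) * k a * a.2)), ?_⟩
        simp only [pairing, toAdd_ofAdd]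
        linear_combination k a * h1
      have hline : ∀ a : ZMod 3 × ZMod 3, a ≠ 0 → ∀ c : ZMod 3 × ZMod 3,
          a.1 * c.2 - a.2 * c.1 = 0 → c = 0 ∨ c = a ∨ c = -a := by decide
      refine ⟨g, fun c hc => ?_⟩
      rcases hline a ha0 c (h a ha c hc) with rfl | rfl | rfl
      · rw [pairing_zero, hk0 hc]
      · exact hga
      · rw [pairing_neg, hga, hkneg a ha]
    · push Not at h0
      refine ⟨1, fun c hc => ?_⟩
      obtain rfl := h0 c hc
      rw [pairing_zero, hk0 hc]

lemma exists_stdAddChar_eq_of_pow_three {c : ℂ} (hc : c ^ 3 = 1) :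
    ∃ k : ZMod 3, c = ZMod.stdAddChar k := by
  have hω : IsPrimitiveRoot (ZMod.stdAddChar (1 : ZMod 3)) 3 := by
    have := Complex.isPrimitiveRoot_exp 3 (by norm_num)
    have h := ZMod.stdAddChar_coe (N := 3) 1
    rw [Int.cast_one] at h
    rw [h]
    simpa using this
  obtain ⟨i, -, rfl⟩ := hω.eq_pow_of_pow_eq_one hc
  exact ⟨i • 1, (AddChar.map_nsmul_eq_pow _ _ _).symm⟩

/-! ### Weight functionals and the upper bound -/

section Weights

variable {V : Type*} [AddCommGroup V] [Module ℝ V]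
  (ρ : Representation ℝ (Multiplicative (ZMod 3) × Multiplicative (ZMod 3)) V)

/-- `l : V → ℂ` is a weight functional of weight `a`: translating the argument
by a group element multiplies the value by the character of weight `a`. The functional `l = 0` is
allowed, and `l` is only `ℝ`-linear, as `V` is a real vector space. -/
def IsWeight (a : ZMod 3 × ZMod 3) (l : V →ₗ[ℝ] ℂ) : Prop :=
  ∀ g v, l (ρ g v) = ZMod.stdAddChar (pairing a g) * l v

variable {ρ}

lemma IsWeight.conj {a : ZMod 3 × ZMod 3} {l : V →ₗ[ℝ] ℂ} (hl : IsWeight ρ a l) :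
    IsWeight ρ (-a) (Complex.conjAe.toLinearMap ∘ₗ l) := by
  intro g v
  simp [hl g v, pairing_neg, AddChar.map_neg_eq_conj]

lemma sum_stdAddChar_neg_pairing (g : Multiplicative (ZMod 3) × Multiplicative (ZMod 3)) :
    ∑ a, (ZMod.stdAddChar (-pairing a g) : ℂ) = if g = 1 then 9 else 0 := by
  have h : ∀ a, (ZMod.stdAddChar (-pairing a g) : ℂ) =
      ZMod.stdAddChar (a.1 * -g.1.toAdd) * ZMod.stdAddChar (a.2 * -g.2.toAdd) := fun a => by
    rw [← AddChar.map_add_eq_mul]; congr 1; simp only [pairing]; ring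
  simp_rw [h]
  rw [Fintype.sum_prod_type]
  dsimp only
  rw [← Fintype.sum_mul_sum,
    AddChar.sum_mulShift _ (ZMod.isPrimitive_stdAddChar 3),
    AddChar.sum_mulShift _ (ZMod.isPrimitive_stdAddChar 3)]
  rcases g with ⟨g₁, g₂⟩
  by_cases h1 : g₁ = 1 <;> by_cases h2 : g₂ = 1 <;> simp [h1, h2, Prod.ext_iff]
  norm_num

/-- The Fourier coefficient of a real functional at the weight `a`. -/
noncomputable def weightPart
    (ρ : Representation ℝ (Multiplicative (ZMod 3) × Multiplicative (ZMod 3)) V)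
    (φ : Module.Dual ℝ V) (a : ZMod 3 × ZMod 3) : V →ₗ[ℝ] ℂ :=
  ∑ g, (ZMod.stdAddChar (-pairing a g) : ℂ) • (Complex.ofRealCLM.toLinearMap ∘ₗ φ ∘ₗ ρ g)

lemma weightPart_apply (φ : Module.Dual ℝ V) (a : ZMod 3 × ZMod 3) (v : V) :
    weightPart ρ φ a v = ∑ g, ZMod.stdAddChar (-pairing a g) * (φ (ρ g v) : ℂ) := by
  simp [weightPart, LinearMap.sum_apply]

lemma isWeight_weightPart (φ : Module.Dual ℝ V) (a : ZMod 3 × ZMod 3) :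
    IsWeight ρ a (weightPart ρ φ a) := by
  intro h v
  rw [weightPart_apply, weightPart_apply, Finset.mul_sum]
  refine Fintype.sum_equiv (Equiv.mulRight h) _ _ fun g => ?_
  rw [Equiv.coe_mulRight, ← mul_assoc, ← AddChar.map_add_eq_mul, map_mul, Module.End.mul_apply,
    pairing_mul]
  congr 3
  ring

lemma sum_weightPart (φ : Module.Dual ℝ V) (v : V) :
    ∑ a, weightPart ρ φ a v = 9 * φ v := by
  simp_rw [weightPart_apply]
  rw [Finset.sum_comm]
  simp_rw [← Finset.sum_mul, sum_stdAddChar_neg_pairing]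
  simp

/-- Weight functionals separate points, by Fourier inversion. -/
lemma eq_of_forall_isWeight {x y : V} (h : ∀ a l, IsWeight ρ a l → l x = l y) : x = y := by
  rw [← sub_eq_zero, ← Module.forall_dual_apply_eq_zero_iff ℝ]
  intro φ
  have h1 : (9 : ℂ) * φ x = 9 * φ y := by
    rw [← sum_weightPart (ρ := ρ), ← sum_weightPart (ρ := ρ)]
    exact Finset.sum_congr rfl fun a _ => h a _ (isWeight_weightPart φ a)
  rw [map_sub, sub_eq_zero]
  exact_mod_cast mul_left_cancel₀ (by norm_num) h1

variable {ι : Type*} [Fintype ι] {b : Module.Basis ι ℝ V} {v w : V}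

lemma IsWeight.mul_conj_eq
    (hvw : ∀ f ∈ invariants b ρ, f.totalDegree ≤ 3 → evalAt b f v = evalAt b f w)
    {a : ZMod 3 × ZMod 3} {l m : V →ₗ[ℝ] ℂ} (hl : IsWeight ρ a l) (hm : IsWeight ρ a m) :
    l v * starRingEnd ℂ (m v) = l w * starRingEnd ℂ (m w) := by
  refine ((IsComplexPoly.of_linearMap b l).mul (.of_linearMap b
    (Complex.conjAe.toLinearMap ∘ₗ m))).eq_of_invariant (by norm_num) (fun g u => ?_) hvw
  have h : (ZMod.stdAddChar (pairing a g) : ℂ) * ZMod.stdAddChar (pairing (-a) g) = 1 := by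
    rw [← AddChar.map_add_eq_mul, ← pairing_add, add_neg_cancel, pairing_zero,
      AddChar.map_zero_eq_one]
  rw [hl g u, hm.conj g u]
  linear_combination (l u * (Complex.conjAe.toLinearMap ∘ₗ m) u) * h

lemma IsWeight.mul_mul_eq
    (hvw : ∀ f ∈ invariants b ρ, f.totalDegree ≤ 3 → evalAt b f v = evalAt b f w)
    {a a' a'' : ZMod 3 × ZMod 3} (ha : a + a' + a'' = 0) {l l' l'' : V →ₗ[ℝ] ℂ}
    (hl : IsWeight ρ a l) (hl' : IsWeight ρ a' l') (hl'' : IsWeight ρ a'' l'') :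
    l v * l' v * l'' v = l w * l' w * l'' w := by
  refine (((IsComplexPoly.of_linearMap b l).mul (.of_linearMap b l')).mul
    (.of_linearMap b l'')).eq_of_invariant (by norm_num) (fun g u => ?_) hvw
  have h : (ZMod.stdAddChar (pairing a g) : ℂ) * ZMod.stdAddChar (pairing a' g) *
      ZMod.stdAddChar (pairing a'' g) = 1 := by
    rw [← AddChar.map_add_eq_mul, ← AddChar.map_add_eq_mul, ← pairing_add, ← pairing_add, ha,
      pairing_zero, AddChar.map_zero_eq_one]
  rw [hl g u, hl' g u, hl'' g u]
  linear_combination (l u * l' u * l'' u) * h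

/-- If `v` and `w` agree on the invariants of degree at most three, then for each weight the
values of its functionals at `v` and `w` differ by one cube root of unity: the quadratic invariants yield a common phase, the
cubes of weight functionals show that its cube is one. -/
lemma exists_phase
    (hvw : ∀ f ∈ invariants b ρ, f.totalDegree ≤ 3 → evalAt b f v = evalAt b f w)
    (a : ZMod 3 × ZMod 3) :
    ∃ k : ZMod 3, ∀ l, IsWeight ρ a l → l w = ZMod.stdAddChar k * l v := by
  by_cases h : ∃ m, IsWeight ρ a m ∧ m v ≠ 0
  · obtain ⟨m, hm, hmv⟩ := h
    have h2 := hm.mul_conj_eq hvw hm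
    have hmw : m w ≠ 0 := fun h0 => by simp [h0, hmv] at h2
    have h3 : m v * m v * m v = m w * m w * m w := hm.mul_mul_eq hvw
      ((by decide : ∀ a : ZMod 3 × ZMod 3, a + a + a = 0) a) hm hm
    obtain ⟨k, hk⟩ := exists_stdAddChar_eq_of_pow_three (c := m w / m v) (by
      rw [div_pow, div_eq_one_iff_eq (pow_ne_zero 3 hmv)]
      linear_combination -h3)
    refine ⟨k, fun l hl => ?_⟩
    have h4 := hl.mul_conj_eq hvw hm
    rw [← hk]
    have hmw' : starRingEnd ℂ (m w) ≠ 0 := by simpa using hmw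
    have : l w * m v = m w * l v := by
      apply mul_right_cancel₀ hmw'
      linear_combination l v * h2 - m v * h4
    field_simp
    linear_combination this
  · push Not at h
    refine ⟨0, fun l hl => ?_⟩
    have h2 := hl.mul_conj_eq hvw hl
    rw [h l hl] at h2 ⊢
    simpa using h2.symm

/-- Vectors that agree on the invariants of degree at most three lie in the same orbit. -/
lemma exists_eq_of_forall_invariants
    (hvw : ∀ f ∈ invariants b ρ, f.totalDegree ≤ 3 → evalAt b f v = evalAt b f w) :
    ∃ g, ρ g v = w := by
  choose k hk using exists_phase hvw
  have hinj := ZMod.injective_stdAddChar (N := 3)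
  obtain ⟨g, hg⟩ := exists_pairing_eq {a | ∃ l, IsWeight ρ a l ∧ l v ≠ 0} k
    (fun a ⟨l, hl, hlv⟩ => ⟨_, hl.conj, by simpa using hlv⟩)
    (fun a ⟨l, hl, hlv⟩ => by
      have h1 := hk _ _ hl.conj
      have h2 := hk _ _ hl
      simp only [LinearMap.comp_apply, AlgEquiv.toLinearMap_apply, Complex.conjAe_coe, h2,
        map_mul, ← AddChar.map_neg_eq_conj] at h1
      exact (hinj (mul_right_cancel₀ (by simpa using hlv) h1)).symm)
    (fun a ⟨l, hl, hlv⟩ a' ⟨l', hl', hlv'⟩ a'' ⟨l'', hl'', hlv''⟩ ha => by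
      have h := hl.mul_mul_eq hvw ha hl' hl''
      rw [hk _ _ hl, hk _ _ hl', hk _ _ hl''] at h
      apply hinj
      rw [AddChar.map_add_eq_mul, AddChar.map_add_eq_mul, AddChar.map_zero_eq_one]
      apply mul_right_cancel₀ (mul_ne_zero (mul_ne_zero hlv hlv') hlv'')
      linear_combination -h)
  refine ⟨g, eq_of_forall_isWeight (ρ := ρ) fun a l hl => ?_⟩
  rw [hl g v, hk a l hl]
  by_cases hlv : l v = 0
  · simp [hlv]
  · rw [hg a ⟨l, hl, hlv⟩]

lemma separatedInDegree_three (b : Module.Basis ι ℝ V) : SeparatedInDegree b ρ 3 := by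
  intro v w hne
  by_contra! h
  obtain ⟨g, rfl⟩ := exists_eq_of_forall_invariants h
  refine hne (Set.ext fun x => ⟨?_, ?_⟩)
  · rintro ⟨s, rfl⟩
    exact ⟨s * g⁻¹, by simp [← Module.End.mul_apply, ← map_mul]⟩
  · rintro ⟨s, rfl⟩
    exact ⟨s * g, by simp⟩

end Weights

/-! ### The lower bound -/

section LowerBound

/-- The odd part of a polynomial of degree at most two is linear. -/
lemma exists_linearMap_eval_sub_eval_neg {ι : Type*} [Fintype ι] (f : MvPolynomial ι ℝ)
    (hf : f.totalDegree ≤ 2) :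
    ∃ L : (ι → ℝ) →ₗ[ℝ] ℝ, ∀ x, MvPolynomial.eval x f - MvPolynomial.eval (-x) f = L x := by
  have hmon : ∀ s ∈ f.support, ∃ L : (ι → ℝ) →ₗ[ℝ] ℝ,
      ∀ x, (∏ i, x i ^ s i) - ∏ i, (-x) i ^ s i = L x := fun s hs => by
    have hdeg : s.degree ≤ 2 := (MvPolynomial.le_totalDegree hs).trans hf
    have hneg : ∀ x : ι → ℝ, ∏ i, (-x) i ^ s i = (-1) ^ s.degree * ∏ i, x i ^ s i := fun x => by
      rw [Finsupp.degree_eq_sum, ← Finset.prod_pow_eq_pow_sum, ← Finset.prod_mul_distrib]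
      exact Finset.prod_congr rfl fun i _ => by rw [Pi.neg_apply, neg_pow]
    by_cases h1 : s.degree = 1
    · obtain ⟨i, rfl⟩ := (Finsupp.sum_eq_one_iff s).1 h1
      refine ⟨2 • LinearMap.proj i, fun x => ?_⟩
      have hx : ∏ j, x j ^ (Finsupp.single i 1 : ι →₀ ℕ) j = x i := by
        rw [Finset.prod_eq_single i (fun j _ hj => by simp [Finsupp.single_eq_of_ne hj])
          (by simp), Finsupp.single_eq_same, pow_one]
      rw [hneg, h1, hx, LinearMap.smul_apply, LinearMap.proj_apply, nsmul_eq_mul]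
      push_cast
      ring
    · refine ⟨0, fun x => ?_⟩
      have : s.degree = 0 ∨ s.degree = 2 := by omega
      rw [hneg]
      rcases this with h | h <;> simp [h]
  choose! L hL using hmon
  refine ⟨∑ s ∈ f.support, f.coeff s • L s, fun x => ?_⟩
  rw [MvPolynomial.eval_eq', MvPolynomial.eval_eq', ← Finset.sum_sub_distrib,
    LinearMap.sum_apply]
  refine Finset.sum_congr rfl fun s hs => ?_
  rw [LinearMap.smul_apply, ← hL s hs, smul_eq_mul, mul_sub]

/-- The action of `C₃ × C₃` on the real plane `ℂ`, where the first factor acts by rotations. -/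
noncomputable def rotation :
    Representation ℝ (Multiplicative (ZMod 3) × Multiplicative (ZMod 3)) ℂ where
  toFun g := LinearMap.mulLeft ℝ (ZMod.stdAddChar g.1.toAdd)
  map_one' := by ext; simp
  map_mul' g h := by
    ext; simp [AddChar.map_add_eq_mul]

lemma rotation_apply (g : Multiplicative (ZMod 3) × Multiplicative (ZMod 3)) (z : ℂ) :
    rotation g z = ZMod.stdAddChar g.1.toAdd * z := rfl

lemma orbit_rotation_ne : orbit rotation 1 ≠ orbit rotation (-1) := by
  intro h
  have h1 : (1 : ℂ) ∈ orbit rotation (-1) := h ▸ ⟨1, by simp⟩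
  obtain ⟨g, hg⟩ := h1
  have h3 : (ZMod.stdAddChar g.1.toAdd : ℂ) ^ 3 = 1 := by
    rw [← AddChar.map_nsmul_eq_pow, (by decide : ∀ x : ZMod 3, 3 • x = 0),
      AddChar.map_zero_eq_one]
  have hg' : (ZMod.stdAddChar g.1.toAdd : ℂ) = -1 := by
    have : (ZMod.stdAddChar g.1.toAdd : ℂ) * -1 = 1 := hg
    linear_combination -this
  rw [hg'] at h3
  norm_num at h3

/-- Invariants of degree at most two do not distinguish `1` from `-1`: the odd part of an invariant
is invariant, and it is linear in degree at most two, hence zero because the cube roots of unity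
sum to zero. -/
lemma evalAt_one_eq_evalAt_neg_one {ι : Type*} [Fintype ι] (b : Module.Basis ι ℝ ℂ)
    {f : MvPolynomial ι ℝ} (hf : f ∈ invariants b rotation) (hdeg : f.totalDegree ≤ 2) :
    evalAt b f 1 = evalAt b f (-1) := by
  obtain ⟨L, hL⟩ := exists_linearMap_eval_sub_eval_neg f hdeg
  have hL' : ∀ z, evalAt b f z - evalAt b f (-z) = (L ∘ₗ b.equivFun.toLinearMap) z := fun z => by
    have := hL (b.equivFun z)
    rw [← map_neg] at this
    exact this
  have hinv := (mem_invariants_iff b rotation f).1 hf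
  have hLinv : ∀ k : ZMod 3, (L ∘ₗ b.equivFun.toLinearMap) (ZMod.stdAddChar k) =
      (L ∘ₗ b.equivFun.toLinearMap) 1 := fun k => by
    have h1 := hinv (.ofAdd k, 1) 1
    have h2 := hinv (.ofAdd k, 1) (-1)
    simp only [rotation_apply, toAdd_ofAdd, mul_one, mul_neg] at h1 h2
    rw [← hL', ← hL', h1, h2]
  have hsum : ∑ k : ZMod 3, (ZMod.stdAddChar k : ℂ) = 0 := by
    simpa using AddChar.sum_mulShift (1 : ZMod 3) (ZMod.isPrimitive_stdAddChar 3)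
  have h0 := congrArg (L ∘ₗ b.equivFun.toLinearMap) hsum
  rw [map_sum, Finset.sum_congr rfl fun k _ => hLinv k, map_zero, Finset.sum_const,
    Finset.card_univ, ZMod.card, ← hL', smul_eq_zero] at h0
  exact sub_eq_zero.1 (h0.resolve_left (by norm_num))

lemma three_le_of_separatedInDegree_rotation {ι : Type*} [Fintype ι] (b : Module.Basis ι ℝ ℂ)
    {d : ℕ} (h : SeparatedInDegree b rotation d) : 3 ≤ d := by
  by_contra! hd
  obtain ⟨f, hf, hfd, hne⟩ := h 1 (-1) orbit_rotation_ne
  exact hne (evalAt_one_eq_evalAt_neg_one b hf (by omega))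

end LowerBound

end SepInv

theorem proposition5p6 :
    SepInv.separatingNoetherNumber ℝ
      (Multiplicative (ZMod 3) × Multiplicative (ZMod 3)) = 3 := by
  apply le_antisymm
  · refine sSup_le ?_
    rintro e ⟨V, _, _, _, ρ, rfl⟩
    exact sInf_le ⟨3, by norm_num, SepInv.separatedInDegree_three _, rfl⟩
  · refine le_sSup_of_le ⟨ℂ, _, _, inferInstance, SepInv.rotation, rfl⟩ (le_sInf ?_)
    rintro e ⟨d, -, hd, rfl⟩
    exact_mod_cast SepInv.three_le_of_separatedInDegree_rotation _ hd
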